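/- Call a list $(\delta_1,\dots,\delta_5)$ of five complex numbers (repetitions allowed) realizable if there is an entrywise non-negative real $5\times 5$ matrix $A$ whose eigenvalues, counted with algebraic multiplicity, are $\delta_1,\dots,\delta_5$. Call it persymmetrically realizable if such an $A$ can be chosen persymmetric, that is, with $a_{ij}=a_{6-j,\,6-i}$ for all $1\le i,j\le 5$. Theorem. Let $\delta_1,\dots,\delta_5$ be complex numbers with $\delta_1+\delta_2+\delta_3+\delta_4+\delta_5=0$. If the list $(\delta_1,\dots,\delta_5)$ is realizable, then it is persymmetrically realizable. Consequently, for lists of five complex numbers with zero sum the non-negative inverse eigenvalue problem and the persymmetric non-negative inverse eigenvalue problem are equivalent: such a list is realizable if and only if it is persymmetrically realizable. -/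

import Mathlib

/-- The spectrum of the real `n × n` matrix `A`, counted with algebraic multiplicity, is the list
`δ` of `n` complex numbers: the roots of the characteristic polynomial of `A` over `ℂ`, as a
multiset, are `δ 0, …, δ (n - 1)`. -/
def HasSpectrum {n : ℕ} (A : Matrix (Fin n) (Fin n) ℝ) (δ : Fin n → ℂ) : Prop :=
  (A.map (algebraMap ℝ ℂ)).charpoly.roots = Multiset.map δ Finset.univ.val

/-- An entrywise non-negative real matrix. -/
def IsNonnegMatrix {n : ℕ} (A : Matrix (Fin n) (Fin n) ℝ) : Prop :=
  ∀ i j, 0 ≤ A i j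

/-- A persymmetric matrix, i.e. one symmetric about its anti-diagonal. With indices `1, …, n` this
reads `a i j = a (n - j + 1) (n - i + 1)`; `Fin.rev` is the reversal of indices. -/
def IsPersymmetric {n : ℕ} (A : Matrix (Fin n) (Fin n) ℝ) : Prop :=
  ∀ i j, A i j = A j.rev i.rev

/-- A list of `n` complex numbers is realizable if it is the spectrum of a non-negative matrix. -/
def IsRealizable {n : ℕ} (δ : Fin n → ℂ) : Prop :=
  ∃ A : Matrix (Fin n) (Fin n) ℝ, IsNonnegMatrix A ∧ HasSpectrum A δ

/-- A list of `n` complex numbers is persymmetrically realizable if it is the spectrum of a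
non-negative persymmetric matrix. -/
def IsPersymmetricallyRealizable {n : ℕ} (δ : Fin n → ℂ) : Prop :=
  ∃ A : Matrix (Fin n) (Fin n) ℝ, IsNonnegMatrix A ∧ IsPersymmetric A ∧ HasSpectrum A δ

/-! A non-negative matrix with zero trace has zero diagonal, so its characteristic polynomial is X^5
- aX^3 - bX^2 - cX - d, where a and b are the total weights of the 2- and 3-cycles, c is the 4-cycle
weight minus that of disjoint 2-cycle pairs, and d the 5-cycle weight minus that of disjoint pairs
of a 2- and a 3-cycle.

Both kinds of realizability amount to the same condition: b ≥ 0 and, for some 0 ≤ m ≤ a, c ≥ -m(a -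
m) and d ≥ -mb. Necessity (`exists_coeff_bound`): take for m the larger of a/2 and the heaviest
2-cycle weight. Disjointness of the ten 2-cycles is the Petersen graph, whose lack of triangles
bounds the negative part of c. Sufficiency (`attains_of_bounds`): three explicit persymmetric
families, chosen by the signs of c and d. -/

namespace ZeroTrace

open Polynomial

/-! ### Cycle weights and the characteristic polynomial -/

/-- The weight of the 2-cycle on `{i, j}`. -/
def cycle2 (M : Matrix (Fin 5) (Fin 5) ℝ) (i j : Fin 5) : ℝ := M i j * M j i

/-- The total weight of the 3-cycles on `{i, j, k}`. -/
def cycle3 (M : Matrix (Fin 5) (Fin 5) ℝ) (i j k : Fin 5) : ℝ :=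
  M i j * M j k * M k i + M i k * M k j * M j i

/-- The total weight of the 4-cycles on `{i, j, k, l}`. -/
def cycle4 (M : Matrix (Fin 5) (Fin 5) ℝ) (i j k l : Fin 5) : ℝ :=
  M i j * M j k * M k l * M l i + M i j * M j l * M l k * M k i +
  M i k * M k j * M j l * M l i + M i k * M k l * M l j * M j i +
  M i l * M l j * M j k * M k i + M i l * M l k * M k j * M j i

/-- The total weight of the 5-cycles that start along the edge from `0` to `i`. -/
def cycle5 (M : Matrix (Fin 5) (Fin 5) ℝ) (i j k l : Fin 5) : ℝ :=
  M 0 i *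
  (M i j * M j k * M k l * M l 0 + M i j * M j l * M l k * M k 0 +
  M i k * M k j * M j l * M l 0 + M i k * M k l * M l j * M j 0 +
  M i l * M l j * M j k * M k 0 + M i l * M l k * M k j * M j 0)

/-- The total weight of the 2-cycles. -/
def sum2 (M : Matrix (Fin 5) (Fin 5) ℝ) : ℝ :=
    cycle2 M 0 1 + cycle2 M 0 2 + cycle2 M 0 3 + cycle2 M 0 4 + cycle2 M 1 2 + cycle2 M 1 3 +
    cycle2 M 1 4 + cycle2 M 2 3 + cycle2 M 2 4 + cycle2 M 3 4

/-- The total weight of the 3-cycles. -/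
def sum3 (M : Matrix (Fin 5) (Fin 5) ℝ) : ℝ :=
    cycle3 M 0 1 2 + cycle3 M 0 1 3 + cycle3 M 0 1 4 + cycle3 M 0 2 3 + cycle3 M 0 2 4 +
    cycle3 M 0 3 4 + cycle3 M 1 2 3 + cycle3 M 1 2 4 + cycle3 M 1 3 4 + cycle3 M 2 3 4

/-- The total weight of the 4-cycles. -/
def sum4 (M : Matrix (Fin 5) (Fin 5) ℝ) : ℝ :=
    cycle4 M 0 1 2 3 + cycle4 M 0 1 2 4 + cycle4 M 0 1 3 4 + cycle4 M 0 2 3 4 + cycle4 M 1 2 3 4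

/-- The total weight of the 5-cycles. -/
def sum5 (M : Matrix (Fin 5) (Fin 5) ℝ) : ℝ :=
    cycle5 M 1 2 3 4 + cycle5 M 2 1 3 4 + cycle5 M 3 1 2 4 + cycle5 M 4 1 2 3

/-- The total weight of the pairs of disjoint 2-cycles. -/
def sum22 (M : Matrix (Fin 5) (Fin 5) ℝ) : ℝ :=
    cycle2 M 0 1 * cycle2 M 2 3 + cycle2 M 0 1 * cycle2 M 2 4 + cycle2 M 0 1 * cycle2 M 3 4 +
    cycle2 M 0 2 * cycle2 M 1 3 + cycle2 M 0 2 * cycle2 M 1 4 + cycle2 M 0 2 * cycle2 M 3 4 +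
    cycle2 M 0 3 * cycle2 M 1 2 + cycle2 M 0 3 * cycle2 M 1 4 + cycle2 M 0 3 * cycle2 M 2 4 +
    cycle2 M 0 4 * cycle2 M 1 2 + cycle2 M 0 4 * cycle2 M 1 3 + cycle2 M 0 4 * cycle2 M 2 3 +
    cycle2 M 1 2 * cycle2 M 3 4 + cycle2 M 1 3 * cycle2 M 2 4 + cycle2 M 1 4 * cycle2 M 2 3

/-- The total weight of the disjoint pairs of a 2-cycle and a 3-cycle. -/
def sum23 (M : Matrix (Fin 5) (Fin 5) ℝ) : ℝ :=
    cycle2 M 0 1 * cycle3 M 2 3 4 + cycle2 M 0 2 * cycle3 M 1 3 4 + cycle2 M 0 3 * cycle3 M 1 2 4 +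
    cycle2 M 0 4 * cycle3 M 1 2 3 + cycle2 M 1 2 * cycle3 M 0 3 4 + cycle2 M 1 3 * cycle3 M 0 2 4 +
    cycle2 M 1 4 * cycle3 M 0 2 3 + cycle2 M 2 3 * cycle3 M 0 1 4 + cycle2 M 2 4 * cycle3 M 0 1 3 +
    cycle2 M 3 4 * cycle3 M 0 1 2

theorem det_fin_four {R : Type*} [CommRing R] (A : Matrix (Fin 4) (Fin 4) R) :
    A.det =
      A 0 0 * (A.submatrix ![1, 2, 3] ![1, 2, 3]).det
      - A 0 1 * (A.submatrix ![1, 2, 3] ![0, 2, 3]).det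
      + A 0 2 * (A.submatrix ![1, 2, 3] ![0, 1, 3]).det
      - A 0 3 * (A.submatrix ![1, 2, 3] ![0, 1, 2]).det := by
  rw [Matrix.det_succ_row_zero]
  simp only [Matrix.det_fin_three, Fin.sum_univ_four, Matrix.submatrix_apply]
  simp [Fin.succAbove]
  ring

theorem det_fin_five {R : Type*} [CommRing R] (A : Matrix (Fin 5) (Fin 5) R) :
    A.det =
      A 0 0 * (A.submatrix ![1, 2, 3, 4] ![1, 2, 3, 4]).det
      - A 0 1 * (A.submatrix ![1, 2, 3, 4] ![0, 2, 3, 4]).det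
      + A 0 2 * (A.submatrix ![1, 2, 3, 4] ![0, 1, 3, 4]).det
      - A 0 3 * (A.submatrix ![1, 2, 3, 4] ![0, 1, 2, 4]).det
      + A 0 4 * (A.submatrix ![1, 2, 3, 4] ![0, 1, 2, 3]).det := by
  have hs : (Fin.succ : Fin 4 → Fin 5) = ![1, 2, 3, 4] := by decide
  have h0 : (0 : Fin 5).succAbove = ![1, 2, 3, 4] := by decide
  have h1 : (1 : Fin 5).succAbove = ![0, 2, 3, 4] := by decide
  have h2 : (2 : Fin 5).succAbove = ![0, 1, 3, 4] := by decide
  have h3 : (3 : Fin 5).succAbove = ![0, 1, 2, 4] := by decide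
  have h4 : (4 : Fin 5).succAbove = ![0, 1, 2, 3] := by decide
  rw [Matrix.det_succ_row_zero, Fin.sum_univ_five, hs, h0, h1, h2, h3, h4]
  simp
  ring

/-- The characteristic polynomial of a matrix with zero diagonal, in terms of its cycles. -/
theorem charpoly_eq (M : Matrix (Fin 5) (Fin 5) ℝ) (h : ∀ i, M i i = 0) :
    M.charpoly = X ^ 5 - C (sum2 M) * X ^ 3 - C (sum3 M) * X ^ 2 - C (sum4 M - sum22 M) * X
      - C (sum5 M - sum23 M) := by
  apply Polynomial.funext
  intro x
  have hd : ∀ i, (Matrix.scalar (Fin 5) x - M) i i = x := fun i ↦ by simp [h]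
  have ho : ∀ i j, i ≠ j → (Matrix.scalar (Fin 5) x - M) i j = -M i j := fun i j hij ↦ by
    simp [hij]
  rw [Matrix.eval_charpoly]
  generalize Matrix.scalar (Fin 5) x - M = N at hd ho
  simp only [det_fin_five, det_fin_four, Matrix.det_fin_three, Matrix.submatrix_apply,
    Matrix.cons_val]
  simp only [hd]
  simp (disch := decide) only [ho]
  simp only [eval_sub, eval_pow, eval_X, eval_mul, eval_C, sum2, sum3, sum4, sum22, sum5, sum23,
    cycle2, cycle3, cycle4, cycle5]
  ring

/-! ### Necessary inequalities for the coefficients -/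

theorem cycle2_nonneg {M : Matrix (Fin 5) (Fin 5) ℝ} (h : IsNonnegMatrix M) (i j : Fin 5) :
    0 ≤ cycle2 M i j :=
  mul_nonneg (h i j) (h j i)

theorem cycle3_nonneg {M : Matrix (Fin 5) (Fin 5) ℝ} (h : IsNonnegMatrix M) (i j k : Fin 5) :
    0 ≤ cycle3 M i j k := by
  have h' : ∀ i j, 0 ≤ M i j := h
  unfold cycle3
  apply_rules [add_nonneg, mul_nonneg]

theorem cycle4_nonneg {M : Matrix (Fin 5) (Fin 5) ℝ} (h : IsNonnegMatrix M) (i j k l : Fin 5) :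
    0 ≤ cycle4 M i j k l := by
  have h' : ∀ i j, 0 ≤ M i j := h
  unfold cycle4
  apply_rules [add_nonneg, mul_nonneg]

theorem cycle5_nonneg {M : Matrix (Fin 5) (Fin 5) ℝ} (h : IsNonnegMatrix M) (i j k l : Fin 5) :
    0 ≤ cycle5 M i j k l := by
  have h' : ∀ i j, 0 ≤ M i j := h
  unfold cycle5
  apply_rules [add_nonneg, mul_nonneg]

theorem sum3_nonneg {M : Matrix (Fin 5) (Fin 5) ℝ} (h : IsNonnegMatrix M) : 0 ≤ sum3 M := by
  have h3 := cycle3_nonneg h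
  unfold sum3
  linarith [h3 0 1 2, h3 0 1 3, h3 0 1 4, h3 0 2 3, h3 0 2 4, h3 0 3 4, h3 1 2 3, h3 1 2 4, h3 1 3 4,
    h3 2 3 4]

theorem sum4_nonneg {M : Matrix (Fin 5) (Fin 5) ℝ} (h : IsNonnegMatrix M) : 0 ≤ sum4 M := by
  have h4 := cycle4_nonneg h
  unfold sum4
  linarith [h4 0 1 2 3, h4 0 1 2 4, h4 0 1 3 4, h4 0 2 3 4, h4 1 2 3 4]

theorem sum5_nonneg {M : Matrix (Fin 5) (Fin 5) ℝ} (h : IsNonnegMatrix M) : 0 ≤ sum5 M := by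
  have h5 := cycle5_nonneg h
  unfold sum5
  linarith [h5 1 2 3 4, h5 2 1 3 4, h5 3 1 2 4, h5 4 1 2 3]

theorem sum23_le {M : Matrix (Fin 5) (Fin 5) ℝ} (h : IsNonnegMatrix M) {m : ℝ}
    (hm : ∀ i j, i < j → cycle2 M i j ≤ m) : sum23 M ≤ m * sum3 M := by
  have h3 {i j : Fin 5} (hij : i < j) (k l n : Fin 5) :=
    mul_le_mul_of_nonneg_right (hm i j hij) (cycle3_nonneg h k l n)
  unfold sum23 sum3
  linarith [h3 (show (0 : Fin 5) < 1 by decide) 2 3 4, h3 (show (0 : Fin 5) < 2 by decide) 1 3 4, h3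
    (show (0 : Fin 5) < 3 by decide) 1 2 4, h3 (show (0 : Fin 5) < 4 by decide) 1 2 3, h3 (show
    (1 : Fin 5) < 2 by decide) 0 3 4, h3 (show (1 : Fin 5) < 3 by decide) 0 2 4, h3 (show (1 :
    Fin 5) < 4 by decide) 0 2 3, h3 (show (2 : Fin 5) < 3 by decide) 0 1 4, h3 (show (2 : Fin 5)
    < 4 by decide) 0 1 3, h3 (show (3 : Fin 5) < 4 by decide) 0 1 2]

/-- The Motzkin-Straus bound for the Petersen graph, the graph of disjoint edges of `K₅`. -/
theorem petersen_bound {x01 x02 x03 x04 x12 x13 x14 x23 x24 x34 : ℝ}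
    (hx01 : 0 ≤ x01) (hx02 : 0 ≤ x02) (hx03 : 0 ≤ x03) (hx04 : 0 ≤ x04) (hx12 : 0 ≤ x12)
    (hx13 : 0 ≤ x13) (hx14 : 0 ≤ x14) (hx23 : 0 ≤ x23) (hx24 : 0 ≤ x24) (hx34 : 0 ≤ x34) :
      x01 * x23 + x01 * x24 + x01 * x34 + x02 * x13 + x02 * x14 + x02 * x34 + x03 * x12 + x03 *
      x14 + x03 * x24 + x04 * x12 + x04 * x13 + x04 * x23 + x12 * x34 + x13 * x24 + x14 * x23 ≤
      (x01 + x02 + x03 + x04 + x12 + x13 + x14 + x23 + x24 + x34) ^ 2 / 4 := by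
  obtain ⟨a, ha⟩ : ∃ a, a = x01 + x02 + x03 + x04 + x12 + x13 + x14 + x23 + x24 + x34 := ⟨_, rfl⟩
  obtain ⟨s, hs⟩ : ∃ s, s =
      x01 * x23 + x01 * x24 + x01 * x34 + x02 * x13 + x02 * x14 + x02 * x34 + x03 * x12 + x03 *
      x14 + x03 * x24 + x04 * x12 + x04 * x13 + x04 * x23 + x12 * x34 + x13 * x24 + x14 * x23 := ⟨_, rfl⟩
  -- With N_v the sum of x over the neighbours of v, q = ∑ x_v N_v², while ∑ x_v N_v = 2s.
  obtain ⟨q, hq⟩ : ∃ q, q =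
      x01 * (x23 + x24 + x34) ^ 2 + x02 * (x13 + x14 + x34) ^ 2 + x03 * (x12 + x14 + x24) ^ 2 +
      x04 * (x12 + x13 + x23) ^ 2 + x12 * (x03 + x04 + x34) ^ 2 + x13 * (x02 + x04 + x24) ^ 2 +
      x14 * (x02 + x03 + x23) ^ 2 + x23 * (x01 + x04 + x14) ^ 2 + x24 * (x01 + x03 + x13) ^ 2 +
      x34 * (x01 + x02 + x12) ^ 2 := ⟨_, rfl⟩
  have h1 : 0 ≤ q - 2 * s * a + a ^ 3 / 4 := by
    have : q - 2 * s * a + a ^ 3 / 4 =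
        x01 * ((x23 + x24 + x34) - a / 2) ^ 2 + x02 * ((x13 + x14 + x34) - a / 2) ^ 2 + x03 *
        ((x12 + x14 + x24) - a / 2) ^ 2 + x04 * ((x12 + x13 + x23) - a / 2) ^ 2 + x12 * ((x03 +
        x04 + x34) - a / 2) ^ 2 + x13 * ((x02 + x04 + x24) - a / 2) ^ 2 + x14 * ((x02 + x03 +
        x23) - a / 2) ^ 2 + x23 * ((x01 + x04 + x14) - a / 2) ^ 2 + x24 * ((x01 + x03 + x13) - a
        / 2) ^ 2 + x34 * ((x01 + x02 + x12) - a / 2) ^ 2 := by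
      rw [hq, hs, ha]
      ring
    rw [this]
    positivity
  -- q is the sum of x_u x_v (N_u + N_v) over the edges uv. Without triangles, adjacent vertices
  -- have disjoint neighbourhoods, so N_u + N_v ≤ a.
  have h2 : 0 ≤ a * s - q := by
    rw [hq, hs, ha]
    ring_nf
    positivity
  have ha0 : 0 ≤ a := by rw [ha]; positivity
  rw [← hs, ← ha]
  rcases ha0.eq_or_lt with h0 | h0
  · have hs' : s ≤ a * a := by
      rw [hs, ha]
      rw [← sub_nonneg]
      ring_nf
      positivity
    rw [← h0] at hs' ⊢
    linarith only [hs']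
  · exact le_of_mul_le_mul_left (by linarith only [h1, h2] : a * s ≤ a * (a ^ 2 / 4)) h0

theorem sum22_le {M : Matrix (Fin 5) (Fin 5) ℝ} (h : IsNonnegMatrix M) :
    sum22 M ≤ sum2 M ^ 2 / 4 :=
  petersen_bound (cycle2_nonneg h 0 1) (cycle2_nonneg h 0 2) (cycle2_nonneg h 0 3) (cycle2_nonneg h 0 4)
    (cycle2_nonneg h 1 2) (cycle2_nonneg h 1 3) (cycle2_nonneg h 1 4) (cycle2_nonneg h 2 3)
    (cycle2_nonneg h 2 4) (cycle2_nonneg h 3 4)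

/-- If an edge carries at least half of the total weight, then the weight of the disjoint pairs of
edges is at most the product of the weight of this edge and the weight of all other edges. -/
theorem petersen_bound_of_heavy {p n₁ n₂ n₃ r₁ r₂ r₃ r₄ r₅ r₆ : ℝ}
    (hn₁ : 0 ≤ n₁) (hn₂ : 0 ≤ n₂) (hn₃ : 0 ≤ n₃) (hr₁ : 0 ≤ r₁) (hr₂ : 0 ≤ r₂) (hr₃ : 0 ≤ r₃)
    (hr₄ : 0 ≤ r₄) (hr₅ : 0 ≤ r₅) (hr₆ : 0 ≤ r₆)
    (hp : n₁ + n₂ + n₃ + r₁ + r₂ + r₃ + r₄ + r₅ + r₆ ≤ p) :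
    p * (n₁ + n₂ + n₃) + n₁ * (r₁ + r₂) + n₂ * (r₃ + r₄) + n₃ * (r₅ + r₆) +
      (r₁ * r₄ + r₁ * r₆ + r₃ * r₂ + r₃ * r₆ + r₅ * r₂ + r₅ * r₄) ≤
    p * (n₁ + n₂ + n₃ + r₁ + r₂ + r₃ + r₄ + r₅ + r₆) := by
  have h := mul_le_mul_of_nonneg_right hp (by positivity : 0 ≤ r₁ + r₂ + r₃ + r₄ + r₅ + r₆)
  -- The `nᵢ` are the neighbours of `p`, pairwise non-adjacent, so every edge avoiding `p` has an
  -- endpoint among the `rᵢ`.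
  have h' : p * (n₁ + n₂ + n₃) + n₁ * (r₁ + r₂) + n₂ * (r₃ + r₄) + n₃ * (r₅ + r₆) +
      (r₁ * r₄ + r₁ * r₆ + r₃ * r₂ + r₃ * r₆ + r₅ * r₂ + r₅ * r₄) ≤ p * (n₁ + n₂ + n₃) +
      (n₁ + n₂ + n₃ + r₁ + r₂ + r₃ + r₄ + r₅ + r₆) * (r₁ + r₂ + r₃ + r₄ + r₅ + r₆) := by
    rw [← sub_nonneg]
    ring_nf
    positivity
  linarith only [h, h']

theorem sum22_le_of_heavy {M : Matrix (Fin 5) (Fin 5) ℝ} (h : IsNonnegMatrix M) {i j : Fin 5}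
    (hij : i < j) (hw : sum2 M / 2 ≤ cycle2 M i j) :
    sum22 M ≤ cycle2 M i j * (sum2 M - cycle2 M i j) := by
  have h2 := cycle2_nonneg h
  unfold sum2 at hw
  unfold sum22 sum2
  fin_cases i <;> fin_cases j <;> first | exact absurd hij (by decide) | skip
  all_goals dsimp only [Fin.reduceFinMk, Fin.mk_zero, Fin.mk_one, Fin.zero_eta] at hw ⊢
  · linarith [petersen_bound_of_heavy (p := cycle2 M 0 1) (h2 3 4) (h2 2 4) (h2 2 3) (h2 0 2)
        (h2 1 2) (h2 0 3) (h2 1 3) (h2 0 4) (h2 1 4) (by linarith)]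
  · linarith [petersen_bound_of_heavy (p := cycle2 M 0 2) (h2 3 4) (h2 1 4) (h2 1 3) (h2 0 1)
        (h2 1 2) (h2 0 3) (h2 2 3) (h2 0 4) (h2 2 4) (by linarith)]
  · linarith [petersen_bound_of_heavy (p := cycle2 M 0 3) (h2 2 4) (h2 1 4) (h2 1 2) (h2 0 1)
        (h2 1 3) (h2 0 2) (h2 2 3) (h2 0 4) (h2 3 4) (by linarith)]
  · linarith [petersen_bound_of_heavy (p := cycle2 M 0 4) (h2 2 3) (h2 1 3) (h2 1 2) (h2 0 1)
        (h2 1 4) (h2 0 2) (h2 2 4) (h2 0 3) (h2 3 4) (by linarith)]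
  · linarith [petersen_bound_of_heavy (p := cycle2 M 1 2) (h2 3 4) (h2 0 4) (h2 0 3) (h2 0 1)
        (h2 0 2) (h2 1 3) (h2 2 3) (h2 1 4) (h2 2 4) (by linarith)]
  · linarith [petersen_bound_of_heavy (p := cycle2 M 1 3) (h2 2 4) (h2 0 4) (h2 0 2) (h2 0 1)
        (h2 0 3) (h2 1 2) (h2 2 3) (h2 1 4) (h2 3 4) (by linarith)]
  · linarith [petersen_bound_of_heavy (p := cycle2 M 1 4) (h2 2 3) (h2 0 3) (h2 0 2) (h2 0 1)
        (h2 0 4) (h2 1 2) (h2 2 4) (h2 1 3) (h2 3 4) (by linarith)]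
  · linarith [petersen_bound_of_heavy (p := cycle2 M 2 3) (h2 1 4) (h2 0 4) (h2 0 1) (h2 0 2)
        (h2 0 3) (h2 1 2) (h2 1 3) (h2 2 4) (h2 3 4) (by linarith)]
  · linarith [petersen_bound_of_heavy (p := cycle2 M 2 4) (h2 1 3) (h2 0 3) (h2 0 1) (h2 0 2)
        (h2 0 4) (h2 1 2) (h2 1 4) (h2 2 3) (h2 3 4) (by linarith)]
  · linarith [petersen_bound_of_heavy (p := cycle2 M 3 4) (h2 1 2) (h2 0 2) (h2 0 1) (h2 0 3)
        (h2 0 4) (h2 1 3) (h2 1 4) (h2 2 3) (h2 2 4) (by linarith)]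

theorem cycle2_le_sum2 {M : Matrix (Fin 5) (Fin 5) ℝ} (h : IsNonnegMatrix M) {i j : Fin 5}
    (hij : i < j) : cycle2 M i j ≤ sum2 M := by
  have h2 := cycle2_nonneg h
  unfold sum2
  fin_cases i <;> fin_cases j <;> first | exact absurd hij (by decide) | skip
  all_goals
    dsimp only [Fin.reduceFinMk, Fin.mk_zero, Fin.mk_one, Fin.zero_eta]
    linarith [h2 0 1, h2 0 2, h2 0 3, h2 0 4,
      h2 1 2, h2 1 3, h2 1 4, h2 2 3, h2 2 4, h2 3 4]

/-- Bounds on the coefficients of the characteristic polynomial of a non-negative matrix with zero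
diagonal. -/
theorem exists_coeff_bound {M : Matrix (Fin 5) (Fin 5) ℝ} (h : IsNonnegMatrix M) :
    ∃ m, 0 ≤ m ∧ m ≤ sum2 M ∧ -(m * (sum2 M - m)) ≤ sum4 M - sum22 M ∧
      -(m * sum3 M) ≤ sum5 M - sum23 M := by
  have h4 := sum4_nonneg h
  have h5 := sum5_nonneg h
  obtain ⟨⟨i, j⟩, hij, hmax⟩ := Finset.exists_max_image
    (Finset.univ.filter fun e : Fin 5 × Fin 5 ↦ e.1 < e.2) (fun e ↦ cycle2 M e.1 e.2)
    ⟨(0, 1), by decide⟩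
  simp only [Finset.mem_filter, Finset.mem_univ, true_and, Prod.forall] at hij hmax
  have hle := cycle2_le_sum2 h hij
  have h2 := cycle2_nonneg h i j
  rcases le_total (sum2 M / 2) (cycle2 M i j) with hw | hw
  · refine ⟨_, h2, hle, ?_, ?_⟩
    · linarith [sum22_le_of_heavy h hij hw]
    · linarith [sum23_le h hmax]
  -- At m = a/2 the product m(a - m) is the Motzkin-Straus bound a²/4.
  · refine ⟨sum2 M / 2, by linarith, by linarith, ?_, ?_⟩
    · linarith [sum22_le h]
    · linarith [sum23_le h fun k l hkl ↦ (hmax k l hkl).trans hw]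

/-! ### Persymmetric realizations -/

/-- `X ^ 5 - a X ^ 3 - b X ^ 2 - c X - d` is the characteristic polynomial of a persymmetric
non-negative matrix. -/
def PersymmetricallyAttains (a b c d : ℝ) : Prop :=
  ∃ B : Matrix (Fin 5) (Fin 5) ℝ, IsNonnegMatrix B ∧ IsPersymmetric B ∧
    B.charpoly = X ^ 5 - C a * X ^ 3 - C b * X ^ 2 - C c * X - C d

theorem PersymmetricallyAttains.of_matrix {a b c d : ℝ} (B : Matrix (Fin 5) (Fin 5) ℝ)
    (h₀ : ∀ i, B i i = 0) (h : ∀ i j, 0 ≤ B i j) (hp : ∀ i j, B i j = B j.rev i.rev)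
    (ha : sum2 B = a) (hb : sum3 B = b) (hc : sum4 B - sum22 B = c)
    (hd : sum5 B - sum23 B = d) : PersymmetricallyAttains a b c d :=
  ⟨B, h, hp, by rw [charpoly_eq B h₀, ha, hb, hc, hd]⟩

/-- Non-negative coefficients are attained by a Toeplitz Hessenberg matrix. -/
theorem attains_of_nonneg {a b c d : ℝ} (ha : 0 ≤ a) (hb : 0 ≤ b) (hc : 0 ≤ c) (hd : 0 ≤ d) :
    PersymmetricallyAttains a b c d := by
  -- The matrix below has a = 4p, b = 3q, c = 2r - 3p², d = s - 2pq; these are solved for p, q, r,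
  -- s.
  obtain ⟨p, hp⟩ : ∃ p, p = a / 4 := ⟨_, rfl⟩
  obtain ⟨q, hq⟩ : ∃ q, q = b / 3 := ⟨_, rfl⟩
  obtain ⟨r, hr⟩ : ∃ r, r = (c + 3 * p ^ 2) / 2 := ⟨_, rfl⟩
  obtain ⟨s, hs⟩ : ∃ s, s = d + 2 * p * q := ⟨_, rfl⟩
  have hp0 : 0 ≤ p := by rw [hp]; positivity
  have hq0 : 0 ≤ q := by rw [hq]; positivity
  have hr0 : 0 ≤ r := by rw [hr]; positivity
  have hs0 : 0 ≤ s := by rw [hs]; positivity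
  apply PersymmetricallyAttains.of_matrix
    !![0, p, q, r, s;
       1, 0, p, q, r;
       0, 1, 0, p, q;
       0, 0, 1, 0, p;
       0, 0, 0, 1, 0]
  · intro i; fin_cases i <;> rfl
  · intro i j; fin_cases i <;> fin_cases j <;> simp [hp0, hq0, hr0, hs0]
  · intro i j; fin_cases i <;> fin_cases j <;> rfl
  all_goals simp [sum2, sum3, sum4, sum22, sum5, sum23, cycle2, cycle3, cycle4, cycle5]
  · linarith
  · linarith
  · linarith
  · linarith

/-- The polynomials `(X ^ 2 - m) (X ^ 3 - n X - b) - e` are attained. -/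
theorem attains_of_factor {m n b e : ℝ} (hm : 0 ≤ m) (hn : 0 ≤ n) (hb : 0 ≤ b) (he : 0 ≤ e) :
    PersymmetricallyAttains (m + n) b (-(m * n)) (e - m * b) := by
  have hn' : 0 ≤ n / 2 := by positivity
  have hz := Real.sqrt_nonneg e
  have hz2 := Real.mul_self_sqrt he
  generalize √e = z at hz hz2
  -- The blocks on {0, 4} and {1, 2, 3} have characteristic polynomials X² - m and X³ - nX - b. The
  -- entries z link them only through one 5-cycle, of weight z² = e.
  apply PersymmetricallyAttains.of_matrix
    !![0, z, 0, 0, m;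
       0, 0, 1, 0, 0;
       0, n / 2, 0, 1, 0;
       0, b, n / 2, 0, z;
       1, 0, 0, 0, 0]
  · intro i; fin_cases i <;> rfl
  · intro i j; fin_cases i <;> fin_cases j <;> simp [*]
  · intro i j; fin_cases i <;> fin_cases j <;> rfl
  all_goals simp [sum2, sum3, sum4, sum22, sum5, sum23, cycle2, cycle3, cycle4, cycle5]
  · ring
  · ring
  · rw [← hz2]

/-- The only 2-cycle is {0, 4}, so c has no negative part; the only disjoint pair joins it to the
3-cycle of weight r² on {1, 2, 3}, which makes negative d possible. -/
theorem attains_of_parameters {a r y z : ℝ} (ha : 0 ≤ a) (hr : 0 ≤ r) (hy : 0 ≤ y) (hz : 0 ≤ z) :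
    PersymmetricallyAttains a (r ^ 2 + y ^ 2) (a * z ^ 2 + 2 * z * r * y)
      (z ^ 2 * y ^ 2 - a * r ^ 2) := by
  apply PersymmetricallyAttains.of_matrix
    !![0, z, 0, 0, 1;
       0, 0, 0, 1, 0;
       y, r, 0, 0, 0;
       0, 0, r, 0, z;
       a, 0, y, 0, 0]
  · intro i; fin_cases i <;> rfl
  · intro i j; fin_cases i <;> fin_cases j <;> simp [*]
  · intro i j; fin_cases i <;> fin_cases j <;> rfl
  all_goals simp [sum2, sum3, sum4, sum22, sum5, sum23, cycle2, cycle3, cycle4, cycle5]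
  · ring
  · ring
  · ring

/-- The case `d ≤ 0 ≤ c`: the parameters of `attains_of_parameters` exist by the intermediate value
theorem. -/
theorem attains_of_neg {a b c d : ℝ} (ha : 0 < a) (hc : 0 ≤ c) (hd : d ≤ 0) (hd' : -(a * b) ≤ d) :
    PersymmetricallyAttains a b c d := by
  -- Put w = z², Y = y² and r² = b - Y. Matching d forces this Y, and matching c becomes g(w) = c,
  -- where g(0) = 0 and g(c/a) ≥ c.
  let Y : ℝ → ℝ := fun w ↦ (d + a * b) / (w + a)
  let g : ℝ → ℝ := fun w ↦ a * w + 2 * √w * √(b - Y w) * √(Y w)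
  have hca : 0 ≤ c / a := by positivity
  have hY : ContinuousOn Y (Set.Icc 0 (c / a)) := by
    refine ContinuousOn.div (by fun_prop) (by fun_prop) fun w hw ↦ ?_
    have := hw.1
    positivity
  have hg : ContinuousOn g (Set.Icc 0 (c / a)) := by
    fun_prop
  have hmem : c ∈ Set.Icc (g 0) (g (c / a)) := by
    constructor
    · simpa [g] using hc
    · have h1 : a * (c / a) = c := by field_simp
      have h2 : 0 ≤ 2 * √(c / a) * √(b - Y (c / a)) * √(Y (c / a)) := by positivity
      simp only [g]
      linarith
  obtain ⟨w, ⟨hw, -⟩, hgw⟩ := intermediate_value_Icc hca hg hmem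
  have hwa : 0 < w + a := by positivity
  have hYmul : Y w * (w + a) = d + a * b := div_mul_cancel₀ _ hwa.ne'
  have hY0 : 0 ≤ Y w := div_nonneg (by linarith) hwa.le
  have hYb : 0 ≤ b - Y w := by
    have hb : 0 ≤ b := by
      by_contra hb
      nlinarith
    have : Y w ≤ b := (div_le_iff₀ hwa).2 (by nlinarith)
    linarith
  have := attains_of_parameters ha.le (Real.sqrt_nonneg (b - Y w)) (Real.sqrt_nonneg (Y w))
    (Real.sqrt_nonneg w)
  rw [Real.sq_sqrt hYb, Real.sq_sqrt hY0, Real.sq_sqrt hw] at this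
  convert this using 1
  · ring
  · exact hgw.symm
  · linarith

theorem attains_of_bounds {a b c d m : ℝ} (hb : 0 ≤ b) (hm : 0 ≤ m) (hma : m ≤ a)
    (hc : -(m * (a - m)) ≤ c) (hd : -(m * b) ≤ d) : PersymmetricallyAttains a b c d := by
  have ha : 0 ≤ a := hm.trans hma
  rcases le_total 0 c with hc0 | hc0
  · rcases le_or_gt 0 d with hd0 | hd0
    · exact attains_of_nonneg ha hb hc0 hd0
    · refine attains_of_neg (ha.lt_of_ne ?_) hc0 hd0.le (by nlinarith)
      rintro rfl
      nlinarith
  -- The new factors (a ± s)/2 are the roots of t² - at - c. The larger is at least m, so e = d + (a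
  -- + s)/2 * b ≥ d + mb ≥ 0.
  · have hD : (2 * m - a) ^ 2 ≤ a ^ 2 + 4 * c := by nlinarith
    have hs := Real.sq_sqrt ((sq_nonneg _).trans hD)
    have hs1 : √(a ^ 2 + 4 * c) ≤ a := Real.sqrt_le_iff.2 ⟨ha, by linarith⟩
    have hs2 : 2 * m - a ≤ √(a ^ 2 + 4 * c) := Real.le_sqrt_of_sq_le hD
    generalize √(a ^ 2 + 4 * c) = s at hs hs1 hs2
    have := attains_of_factor (m := (a + s) / 2) (n := (a - s) / 2) (b := b)
      (e := d + (a + s) / 2 * b) (by linarith) (by linarith) hb (by nlinarith)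
    convert this using 1
    · ring
    · linarith
    · ring

end ZeroTrace

theorem mainTheorem1 (δ : Fin 5 → ℂ) (hδ : ∑ i, δ i = 0) :
    IsRealizable δ ↔ IsPersymmetricallyRealizable δ := by
  refine ⟨?_, fun ⟨A, hA, _, hs⟩ ↦ ⟨A, hA, hs⟩⟩
  rintro ⟨A, hA, hs⟩
  have htr : A.trace = 0 := by
    have h1 := Matrix.trace_eq_sum_roots_charpoly (A.map (algebraMap ℝ ℂ))
    rw [hs] at h1
    have h2 : (A.map (algebraMap ℝ ℂ)).trace = 0 := h1.trans hδ
    have h3 : ((A.trace : ℝ) : ℂ) = 0 := by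
      rw [← h2]
      simp [Matrix.trace]
    exact_mod_cast h3
  have hdiag : ∀ i, A i i = 0 := fun i ↦
    (Finset.sum_eq_zero_iff_of_nonneg fun i _ ↦ hA i i).1 htr i (Finset.mem_univ i)
  obtain ⟨m, hm, hma, hc, hd⟩ := ZeroTrace.exists_coeff_bound hA
  obtain ⟨B, hB, hp, hcp⟩ := ZeroTrace.attains_of_bounds (ZeroTrace.sum3_nonneg hA) hm hma hc hd
  refine ⟨B, hB, hp, ?_⟩
  rw [← ZeroTrace.charpoly_eq A hdiag] at hcp
  rw [HasSpectrum, Matrix.charpoly_map, hcp, ← Matrix.charpoly_map]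
  exact hs
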